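/- Let $G$ be a group. A $G$-automaton over a finite alphabet $\Sigma$ consists of a finite set of states with an initial state $q_1$ and a set of accept states, and a transition function $\delta$ assigning to each state and each $\sigma\in\Sigma\cup\{\varepsilon\}$ a finite set of pairs (state, element of $G$). If $(q',g)\in\delta(q,\sigma)$, the automaton in state $q$ may read $\sigma$ (nothing if $\sigma=\varepsilon$), move to $q'$, and replace the content $x\in G$ of its register by $xg$. It accepts a word $w$ if some computation starting in $q_1$ with register $1$ reads all of $w$ and ends in an accept state with register $1$. Let $\mathfrak L(G)$ be the class of all languages over finite alphabets recognized by $G$-automata, and let $\mathsf{CF}$ be the class of context-free languages. Then: 1. $\mathfrak L(SL(2,\mathbb Z))\subsetneq\mathfrak L(SL(2,\mathbb Q))$. 2. The unary language $\mathtt{UPOW_{odd}}=\{a^{2^{2n+1}}\mid n\ge 0\}$ is not regular and is recognized by the following $SL(2,\mathbb Q)$-automaton. Let $$A_1=\begin{pmatrix}2&0\\1&\frac12\end{pmatrix},\quad A_2=\begin{pmatrix}2&0\\0&\frac12\end{pmatrix},\quad A_3=\begin{pmatrix}1&0\\-1&1\end{pmatrix},\quad A_4=\begin{pmatrix}\frac12&0\\0&2\end{pmatrix}.$$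 The states are $0,1,2,3,4$, the initial state is $0$, the only accept state is $4$, and the transitions $q\xrightarrow{\sigma,\,g}q'$ are $$0\xrightarrow{\varepsilon,A_1}1,\quad 1\xrightarrow{\varepsilon,A_2}1,\quad 1\xrightarrow{\varepsilon,I}2,\quad 2\xrightarrow{a,A_3}2,\quad 2\xrightarrow{\varepsilon,I}3,\quad 3\xrightarrow{\varepsilon,A_4}3,\quad 3\xrightarrow{\varepsilon,I}4.$$ 3. $\mathfrak L(SL(2,\mathbb Z))=\mathsf{CF}$, and every language over a one-letter alphabet in $\mathfrak L(SL(2,\mathbb Z))$ is regular. -/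

import Mathlib

/-- `SL(2,ℤ)`. -/
abbrev SLTwoInt : Type := Matrix.SpecialLinearGroup (Fin 2) ℤ

/-- `SL(2,ℚ)`. -/
abbrev SLTwoRat : Type := Matrix.SpecialLinearGroup (Fin 2) ℚ

/-- An extended finite automaton over the group `G` (a `G`-automaton) with input alphabet `A`:
finitely many states, and finitely many transitions, each consuming an input symbol (`some a`) or
nothing (`none`), changing the state, and multiplying the register on the right by an element
of `G`. -/
structure GroupAutomaton (A G : Type) [Group G] where
  /-- The states. -/
  Q : Type
  finite_Q : Finite Q
  /-- The transition function. -/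
  step : Q → Option A → Finset (Q × G)
  /-- The initial state. -/
  start : Q
  /-- The accept states. -/
  accept : Set Q

namespace GroupAutomaton

variable {A G : Type} [Group G]

/-- One step between configurations (state, unread input, register). -/
inductive Step (E : GroupAutomaton A G) : E.Q × List A × G → E.Q × List A × G → Prop
  | eps {q q' : E.Q} {g : G} (w : List A) (x : G) (h : (q', g) ∈ E.step q none) :
      Step E (q, w, x) (q', w, x * g)
  | read {q q' : E.Q} {g : G} (a : A) (w : List A) (x : G) (h : (q', g) ∈ E.step q (some a)) :
      Step E (q, a :: w, x) (q', w, x * g)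

/-- The language recognized by `E`: the words `w` for which some computation that starts in the
initial state with the register equal to `1` reads all of `w` and ends in an accept state with the
register equal to `1`. -/
def language (E : GroupAutomaton A G) : Language A :=
  {w | ∃ q ∈ E.accept, Relation.ReflTransGen E.Step (E.start, w, 1) (q, [], 1)}

end GroupAutomaton

/-- A language together with its finite alphabet. -/
structure FormalLanguage where
  /-- The alphabet. -/
  alphabet : Type
  finite_alphabet : Finite alphabet
  /-- The set of words. -/
  words : Language alphabet

/-- The class of the languages, over arbitrary finite alphabets, recognized by `G`-automata. -/
def languageClass (G : Type) [Group G] : Set FormalLanguage :=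
  {L | ∃ E : GroupAutomaton L.alphabet G, E.language = L.words}

/-- The class of the context-free languages over arbitrary finite alphabets. -/
def contextFreeClass : Set FormalLanguage :=
  {L | L.words.IsContextFree}

/-- The unary language of the words of length `2 ^ (2 * n + 1)`, `n ≥ 0`; the letter is `()`. -/
def UPOWodd : Language Unit :=
  {w | ∃ n : ℕ, w = List.replicate (2 ^ (2 * n + 1)) ()}

namespace UPOWodd

/-- The matrix that initializes the register. -/
def A₁ : SLTwoRat := ⟨!![2, 0; 1, 1 / 2], by norm_num [Matrix.det_fin_two_of]⟩

/-- The matrix used repeatedly before reading the input. -/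
def A₂ : SLTwoRat := ⟨!![2, 0; 0, 1 / 2], by norm_num [Matrix.det_fin_two_of]⟩

/-- The matrix used for each letter read. -/
def A₃ : SLTwoRat := ⟨!![1, 0; -1, 1], by norm_num [Matrix.det_fin_two_of]⟩

/-- The matrix used repeatedly after reading the input. -/
def A₄ : SLTwoRat := ⟨!![1 / 2, 0; 0, 2], by norm_num [Matrix.det_fin_two_of]⟩

/-- The transition function of the automaton below. -/
def delta : Fin 5 → Option Unit → Finset (Fin 5 × SLTwoRat)
  | 0, none => {(1, A₁)}
  | 1, none => {(1, A₂), (2, 1)}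
  | 2, some () => {(2, A₃)}
  | 2, none => {(3, 1)}
  | 3, none => {(3, A₄), (4, 1)}
  | _, _ => ∅

/-- The `SL(2,ℚ)`-automaton for `UPOWodd`, with states `0, 1, 2, 3, 4`. -/
def automaton : GroupAutomaton Unit SLTwoRat where
  Q := Fin 5
  finite_Q := inferInstance
  step := delta
  start := 0
  accept := {4}

end UPOWodd

/-!
A context-free language is recognized by a pushdown automaton, and in a free group on the stack
symbols a push and the matching pop cancel; the stack discipline ensures that a push does not cancel
a pop that precedes it. A free group of infinite rank embeds into `SL(2,ℤ)` by ping-pong on the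
upper half plane, with unit discs centred at integers.

Conversely, `SL(2,ℤ)` is the amalgamated product of two finite subgroups over `{1, -1}`. A word of
length at least two over their union that represents `1` has two consecutive letters in the same
factor: otherwise the word moves `I` so that the sign of the real part reveals the factor of its
first letter. Hence such words can be shortened down to length one, and a computation that
multiplies the register by `1` is parsed by a context-free grammar with one nonterminal for each
triple of two states and an element of the union.

Over one letter only lengths matter. In a finite grammar all long words have a parse tree that
contains a nonterminal which can be pumped, and the product `P` of one pumping length for each of
these nonterminals is a common period: if `n` is a large length, so is `n + P`. Such a set of
lengths is eventually periodic.

In the automaton for `UPOWodd`, `m` and `j` passes through the loops before and after the input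
turn the register on the input `a ^ k` into a lower triangular matrix whose diagonal is trivial
exactly if `j = m + 1`, and whose other entry vanishes exactly if `k = 2 ^ (2 * m + 1)`.
-/

/-! ### Parse trees of context-free grammars -/

section SuffixClosure

variable {α : Type*}

/-- The lists that are a suffix of some list of `S`. These serve as states of automata that work
through a list from left to right. -/
def suffixClosure (S : Set (List α)) : Set (List α) :=
  {u | ∃ l ∈ S, u <:+ l}

lemma subset_suffixClosure {S : Set (List α)} : S ⊆ suffixClosure S :=
  fun l hl => ⟨l, hl, List.suffix_rfl⟩

lemma mem_suffixClosure_of_suffix {S : Set (List α)} {u v : List α} (huv : u <:+ v)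
    (hv : v ∈ suffixClosure S) : u ∈ suffixClosure S := by
  obtain ⟨l, hl, hvl⟩ := hv
  exact ⟨l, hl, huv.trans hvl⟩

lemma finite_suffixClosure {S : Set (List α)} (hS : S.Finite) : (suffixClosure S).Finite := by
  refine (hS.biUnion fun l _ => List.finite_toSet l.tails).subset fun u ⟨l, hl, hul⟩ => ?_
  exact Set.mem_biUnion hl ((List.mem_tails u l).2 hul)

end SuffixClosure

/-- `Yields R s w`: the sentential form `s` derives the terminal word `w` by the context-free rules
in `R`; a proof of it is a forest of parse trees, one for each symbol of `s`. -/
inductive Yields {T N : Type*} (R : Set (ContextFreeRule T N)) :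
    List (Symbol T N) → List T → Prop
  | nil : Yields R [] []
  | terminal (a : T) {s : List (Symbol T N)} {w : List T} (h : Yields R s w) :
      Yields R (.terminal a :: s) (a :: w)
  | nonterminal {r : ContextFreeRule T N} {s : List (Symbol T N)} {u w : List T}
      (hr : r ∈ R) (h₁ : Yields R r.output u) (h₂ : Yields R s w) :
      Yields R (.nonterminal r.input :: s) (u ++ w)

/-- The language of the words that the rules in `R` derive from the nonterminal `A`. -/
def yieldLanguage {T N : Type*} (R : Set (ContextFreeRule T N)) (A : N) : Language T :=
  {w | Yields R [.nonterminal A] w}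

/-- The language denoted by a sentential form when each nonterminal `A` denotes `L A`. -/
def formLanguage {T N : Type*} (L : N → Language T) (s : List (Symbol T N)) : Language T :=
  (s.map fun
    | .terminal a => {[a]}
    | .nonterminal A => L A).prod

namespace Yields

variable {T N : Type*} {R R' : Set (ContextFreeRule T N)} {s t : List (Symbol T N)} {u v w : List T}

lemma append (hs : Yields R s u) (ht : Yields R t v) : Yields R (s ++ t) (u ++ v) := by
  induction hs with
  | nil => exact ht
  | terminal a _ ih => exact .terminal a ih
  | nonterminal hr h₁ _ _ ih =>
    rw [List.append_assoc]
    exact .nonterminal hr h₁ ih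

lemma exists_of_append (h : Yields R (s ++ t) w) :
    ∃ u v, w = u ++ v ∧ Yields R s u ∧ Yields R t v := by
  induction s generalizing w with
  | nil => exact ⟨[], w, rfl, .nil, h⟩
  | cons x s ih =>
    cases h with
    | terminal a h =>
      obtain ⟨u, v, rfl, hu, hv⟩ := ih h
      exact ⟨a :: u, v, rfl, .terminal a hu, hv⟩
    | @nonterminal r _ x _ hr h₁ h₂ =>
      obtain ⟨u, v, rfl, hu, hv⟩ := ih h₂
      exact ⟨x ++ u, v, (List.append_assoc x u v).symm, .nonterminal hr h₁ hu, hv⟩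

lemma of_mem {r : ContextFreeRule T N} (hr : r ∈ R) (h : Yields R r.output w) :
    Yields R [.nonterminal r.input] w := by
  simpa using nonterminal hr h nil

lemma map_terminal (w : List T) : Yields R (w.map Symbol.terminal) w := by
  induction w with
  | nil => exact .nil
  | cons a w ih => exact .terminal a ih

lemma mono (hR : R ⊆ R') (h : Yields R s w) : Yields R' s w := by
  induction h with
  | nil => exact .nil
  | terminal a _ ih => exact .terminal a ih
  | nonterminal hr _ _ ih₁ ih₂ => exact .nonterminal (hR hr) ih₁ ih₂

lemma mem_formLanguage {L : N → Language T} (hL : ∀ r ∈ R, formLanguage L r.output ≤ L r.input)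
    (h : Yields R s w) : w ∈ formLanguage L s := by
  induction h with
  | nil => exact Language.nil_mem_one
  | terminal a _ ih => exact Language.append_mem_mul (Set.mem_singleton [a]) ih
  | nonterminal hr _ _ ih₁ ih₂ => exact Language.append_mem_mul (hL _ hr ih₁) ih₂

lemma derives {g : ContextFreeGrammar T} {s : List (Symbol T g.NT)}
    (h : Yields (g.rules : Set (ContextFreeRule T g.NT)) s w) :
    g.Derives s (w.map Symbol.terminal) := by
  induction h with
  | nil => exact .refl _
  | terminal a _ ih => exact ih.append_left [Symbol.terminal a]
  | @nonterminal r s u w hr _ _ ih₁ ih₂ =>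
    have expand : g.Produces (.nonterminal r.input :: s) (r.output ++ s) := ⟨r, hr, .head s⟩
    rw [List.map_append]
    exact expand.trans_derives ((ih₁.append_right s).trans (ih₂.append_left _))

lemma of_produces {g : ContextFreeGrammar T} {s t : List (Symbol T g.NT)} (hst : g.Produces s t)
    (h : Yields (g.rules : Set (ContextFreeRule T g.NT)) t w) :
    Yields (g.rules : Set (ContextFreeRule T g.NT)) s w := by
  obtain ⟨r, hr, hrw⟩ := hst
  obtain ⟨p, q, rfl, rfl⟩ := hrw.exists_parts
  obtain ⟨_, v, rfl, h', hv⟩ := h.exists_of_append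
  obtain ⟨u, m, rfl, hu, hm⟩ := h'.exists_of_append
  exact (hu.append (of_mem hr hm)).append hv

end Yields

lemma language_eq_yieldLanguage {T : Type*} (g : ContextFreeGrammar T) :
    g.language = yieldLanguage (g.rules : Set (ContextFreeRule T g.NT)) g.initial := by
  ext w
  rw [ContextFreeGrammar.mem_language_iff]
  refine ⟨fun h => ?_, Yields.derives⟩
  change Yields _ [.nonterminal g.initial] w
  generalize [Symbol.nonterminal g.initial] = s at h
  induction h using Relation.ReflTransGen.head_induction_on with
  | refl => exact .map_terminal w
  | head h _ ih => exact .of_produces h ih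

lemma isContextFree_iff_exists_yieldLanguage_eq {T : Type*} {L : Language T} :
    L.IsContextFree ↔
      ∃ (N : Type) (R : Set (ContextFreeRule T N)) (A : N), R.Finite ∧ yieldLanguage R A = L := by
  constructor
  · rintro ⟨g, rfl⟩
    exact ⟨g.NT, g.rules, g.initial, g.rules.finite_toSet, (language_eq_yieldLanguage g).symm⟩
  · rintro ⟨N, R, A, hR, rfl⟩
    refine ⟨⟨N, A, hR.toFinset⟩, ?_⟩
    rw [language_eq_yieldLanguage, hR.coe_toFinset]

/-! ### Computations of automata over groups -/

namespace GroupAutomaton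

section Run

variable {A G : Type} [Group G] {E : GroupAutomaton A G} {q q' q'' : E.Q} {u v w : List A} {g h : G}

/-- `E.Run q w g q'`: some computation from the state `q` to `q'` reads the word `w` and multiplies
the register by `g`. -/
inductive Run (E : GroupAutomaton A G) : E.Q → List A → G → E.Q → Prop
  | nil (q : E.Q) : Run E q [] 1 q
  | step {q q' q'' : E.Q} {σ : Option A} {g h : G} {w : List A} (hs : (q', g) ∈ E.step q σ)
      (hr : Run E q' w h q'') : Run E q (σ.toList ++ w) (g * h) q''

lemma Run.trans (h₁ : E.Run q u g q') (h₂ : E.Run q' v h q'') :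
    E.Run q (u ++ v) (g * h) q'' := by
  induction h₁ with
  | nil q => rwa [one_mul]
  | step hs _ ih =>
    rw [mul_assoc, List.append_assoc]
    exact .step hs (ih h₂)

lemma Run.of_mem_step {σ : Option A} (hs : (q', g) ∈ E.step q σ) : E.Run q σ.toList g q' := by
  simpa using Run.step hs (.nil q')

lemma step_of_mem_step {σ : Option A} (hs : (q', g) ∈ E.step q σ) (w : List A) (x : G) :
    E.Step (q, σ.toList ++ w, x) (q', w, x * g) := by
  cases σ with
  | none => exact .eps w x hs
  | some a => exact .read a w x hs

lemma Run.reflTransGen (hr : E.Run q w g q') (x : G) :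
    Relation.ReflTransGen E.Step (q, w, x) (q', [], x * g) := by
  induction hr generalizing x with
  | nil q => rw [mul_one]
  | step hs _ ih =>
    rw [← mul_assoc]
    exact .head (step_of_mem_step hs _ x) (ih _)

lemma run_of_reflTransGen {c : E.Q × List A × G} {y : G}
    (h : Relation.ReflTransGen E.Step c (q', [], y)) : E.Run c.1 c.2.1 (c.2.2⁻¹ * y) q' := by
  induction h using Relation.ReflTransGen.head_induction_on with
  | refl => simpa using Run.nil q'
  | head h _ ih =>
    cases h with
    | eps w x hs => simpa [mul_assoc] using Run.step hs ih
    | read a w x hs => simpa [mul_assoc] using Run.step hs ih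

lemma mem_language_iff_run : w ∈ E.language ↔ ∃ q ∈ E.accept, E.Run E.start w 1 q := by
  refine exists_congr fun q => and_congr_right fun _ => ⟨fun h => ?_, fun h => ?_⟩
  · simpa using run_of_reflTransGen h
  · simpa using h.reflTransGen 1

end Run

section Map

variable {A G H : Type} [Group G] [Group H]

/-- The automaton obtained from `E` by applying the group homomorphism `f` to the labels of its
transitions. -/
noncomputable def map (f : G →* H) (E : GroupAutomaton A G) : GroupAutomaton A H where
  Q := E.Q
  finite_Q := E.finite_Q
  step q σ := by
    classical
    exact (E.step q σ).image (Prod.map id f)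
  start := E.start
  accept := E.accept

variable {f : G →* H} {E : GroupAutomaton A G}

lemma mem_map_step {q q' : E.Q} {σ : Option A} {y : H} :
    (q', y) ∈ (E.map f).step q σ ↔ ∃ g, (q', g) ∈ E.step q σ ∧ f g = y := by
  classical
  refine (Finset.mem_image (s := E.step q σ)).trans ⟨?_, ?_⟩
  · rintro ⟨⟨p, g⟩, hs, hp⟩
    obtain ⟨rfl, rfl⟩ := Prod.mk.inj hp
    exact ⟨g, hs, rfl⟩
  · rintro ⟨g, hs, rfl⟩
    exact ⟨(q', g), hs, rfl⟩

lemma Run.map {q q' : E.Q} {w : List A} {g : G} (hr : E.Run q w g q') :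
    (E.map f).Run q w (f g) q' := by
  induction hr with
  | nil q =>
    rw [map_one]
    exact .nil (E := E.map f) q
  | step hs _ ih =>
    rw [map_mul]
    exact .step (E := E.map f) (mem_map_step.2 ⟨_, hs, rfl⟩) ih

lemma Run.exists_of_map {q q' : (E.map f).Q} {w : List A} {y : H}
    (hr : (E.map f).Run q w y q') : ∃ g, E.Run q w g q' ∧ f g = y := by
  induction hr with
  | nil q => exact ⟨1, .nil (E := E) q, map_one f⟩
  | step hs _ ih =>
    obtain ⟨h, hr, rfl⟩ := ih
    obtain ⟨g, hg, rfl⟩ := mem_map_step.1 hs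
    exact ⟨g * h, .step hg hr, map_mul f g h⟩

lemma language_map (hf : Function.Injective f) : (E.map f).language = E.language := by
  ext w
  rw [mem_language_iff_run, mem_language_iff_run]
  refine exists_congr fun q => and_congr_right fun _ => ⟨fun hr => ?_, fun hr => ?_⟩
  · obtain ⟨g, hr, hg⟩ := hr.exists_of_map
    rwa [(map_eq_one_iff f hf).1 hg] at hr
  · rw [← map_one f]
    exact hr.map

end Map

end GroupAutomaton

lemma languageClass_subset_of_injective {G H : Type} [Group G] [Group H] {f : G →* H}
    (hf : Function.Injective f) : languageClass G ⊆ languageClass H := by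
  rintro L ⟨E, hE⟩
  exact ⟨E.map f, (GroupAutomaton.language_map hf).trans hE⟩

/-! ### Pushdown automata as automata over free groups -/

section Pushdown

variable {T N : Type} {R : Set (ContextFreeRule T N)}

section StackMove

variable {Q : Set (List (Symbol T N))}

/-- A move of the stack of a pushdown automaton for the rules `R`, as a relation between its states,
which hold the part of a right-hand side that is still to be derived. The move of the letter
`(s, true)` expands a nonterminal and pushes `s`, the form that follows it, and the move of
`(s, false)` completes a right-hand side and pops `s`. -/
inductive StackMove (R : Set (ContextFreeRule T N)) :
    List (Symbol T N) → Q × Bool → List (Symbol T N) → Prop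
  | push {r : ContextFreeRule T N} (hr : r ∈ R) (s : Q) :
      StackMove R (.nonterminal r.input :: s) (s, true) r.output
  | pop (s : Q) : StackMove R [] (s, false) s

/-- A computation of the pushdown automaton for `R`, cut at the stack moves that its third argument
lists; between them the state loses an initial part that derives the word read. -/
inductive CutRun (R : Set (ContextFreeRule T N)) :
    List (Symbol T N) → List T → List (Q × Bool) → List (Symbol T N) → Prop
  | nil {s q : List (Symbol T N)} {w : List T} (hs : Yields R s w) : CutRun R (s ++ q) w [] q
  | cons {s p p' q : List (Symbol T N)} {v w : List T} {x : Q × Bool} {l : List (Q × Bool)}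
      (hs : Yields R s v) (hx : StackMove R p x p') (h : CutRun R p' w l q) :
      CutRun R (s ++ p) (v ++ w) (x :: l) q

namespace CutRun

variable {p q s : List (Symbol T N)} {v w : List T} {l l' : List (Q × Bool)}

lemma append_left (hs : Yields R s v) (h : CutRun R p w l q) :
    CutRun R (s ++ p) (v ++ w) l q := by
  cases h with
  | nil ht => rw [← List.append_assoc]; exact .nil (hs.append ht)
  | cons ht hx h =>
    rw [← List.append_assoc, ← List.append_assoc]
    exact .cons (hs.append ht) hx h

lemma yields_of_nil (h : CutRun R p w ([] : List (Q × Bool)) []) : Yields R p w := by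
  generalize hq : ([] : List (Symbol T N)) = q at h
  cases h with
  | nil hs => rwa [← hq, List.append_nil]

lemma exists_of_cons {x : Q × Bool} (h : CutRun R p w (x :: l) q) :
    ∃ s p₁ p₂ v w', p = s ++ p₁ ∧ w = v ++ w' ∧ Yields R s v ∧ StackMove R p₁ x p₂ ∧
      CutRun R p₂ w' l q := by
  cases h with
  | cons hs hx h => exact ⟨_, _, _, _, _, rfl, rfl, hs, hx, h⟩

/-- A push and the matching pop enclose the derivation of a nonterminal. The opposite order does not
occur: after a pop of `s` the state is `s`, and `s` can only be pushed from a longer state. -/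
lemma cancel {x : Q} {b : Bool} (h : CutRun R p w ((x, b) :: (x, !b) :: l) q) :
    CutRun R p w l q := by
  obtain ⟨s, p₁, p₂, v, w, rfl, rfl, hs, hx, h'⟩ := h.exists_of_cons
  obtain ⟨s', p₃, p₄, v', w, hp, rfl, hs', hx', ht⟩ := h'.exists_of_cons
  refine append_left hs ?_
  cases hx with
  | push hr =>
    cases hx' with
    | pop =>
      rw [List.append_nil] at hp
      rw [← hp] at hs'
      exact append_left (.of_mem hr hs') ht
  | pop =>
    cases hx' with
    | push =>
      have := congrArg List.length hp
      rw [List.length_append, List.length_cons] at this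
      omega

lemma of_step (hl : FreeGroup.Red.Step l l') (h : CutRun R p w l q) : CutRun R p w l' q := by
  obtain @⟨l₁, l₂, x, b⟩ := hl
  induction l₁ generalizing p w with
  | nil => exact h.cancel
  | cons y l₁ ih =>
    cases h with
    | cons hs hy h => exact .cons hs hy (ih h)

lemma of_red (hl : FreeGroup.Red l l') (h : CutRun R p w l q) : CutRun R p w l' q := by
  induction hl with
  | refl => exact h
  | tail _ hstep ih => exact ih.of_step hstep

end CutRun

end StackMove

section Automaton

variable {S : N}

/-- The states of the pushdown automaton for the rules `R` and the initial nonterminal `S`, which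
are also its stack symbols: the suffixes of the right-hand sides and of the initial form. -/
def pushdownForms (R : Set (ContextFreeRule T N)) (S : N) : Set (List (Symbol T N)) :=
  suffixClosure (insert [.nonterminal S] (ContextFreeRule.output '' R))

lemma finite_pushdownForms (hR : R.Finite) (S : N) : (pushdownForms R S).Finite :=
  finite_suffixClosure ((hR.image _).insert _)

lemma initial_mem_pushdownForms : [.nonterminal S] ∈ pushdownForms R S :=
  subset_suffixClosure (Set.mem_insert _ _)

lemma nil_mem_pushdownForms : [] ∈ pushdownForms R S :=
  mem_suffixClosure_of_suffix List.nil_suffix initial_mem_pushdownForms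

lemma output_mem_pushdownForms {r : ContextFreeRule T N} (hr : r ∈ R) :
    r.output ∈ pushdownForms R S :=
  subset_suffixClosure (Set.mem_insert_of_mem _ (Set.mem_image_of_mem _ hr))

/-- The transitions of the pushdown automaton, with the stack recorded as an element of the free
group on the stack symbols. -/
inductive PushdownStep (R : Set (ContextFreeRule T N)) (S : N) (p : pushdownForms R S) :
    Option T → pushdownForms R S × FreeGroup (pushdownForms R S) → Prop
  | read {a : T} {q : pushdownForms R S} (hp : p.1 = .terminal a :: q.1) :
      PushdownStep R S p (some a) (q, 1)
  | move {x : pushdownForms R S × Bool} {q : pushdownForms R S} (hx : StackMove R p.1 x q.1) :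
      PushdownStep R S p none (q, FreeGroup.mk [x])

lemma finite_setOf_pushdownStep (hR : R.Finite) (p : pushdownForms R S) (σ : Option T) :
    {y | PushdownStep R S p σ y}.Finite := by
  have : Finite (pushdownForms R S) := finite_pushdownForms hR S
  refine (Set.finite_range fun y : pushdownForms R S × Option (pushdownForms R S × Bool) =>
    (y.1, FreeGroup.mk y.2.toList)).subset ?_
  rintro _ (@⟨_, q, -⟩ | @⟨x, q, -⟩)
  · exact ⟨(q, none), rfl⟩
  · exact ⟨(q, some x), rfl⟩

/-- The pushdown automaton for the rules `R` and the initial nonterminal `S`, as an automaton over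
the free group on its stack symbols. -/
noncomputable def pushdown (hR : R.Finite) (S : N) :
    GroupAutomaton T (FreeGroup (pushdownForms R S)) where
  Q := pushdownForms R S
  finite_Q := finite_pushdownForms hR S
  step p σ := (finite_setOf_pushdownStep hR p σ).toFinset
  start := ⟨_, initial_mem_pushdownForms⟩
  accept := {⟨_, nil_mem_pushdownForms⟩}

lemma mem_pushdown_step {hR : R.Finite} {p : pushdownForms R S} {σ : Option T}
    {y : pushdownForms R S × FreeGroup (pushdownForms R S)} :
    y ∈ (pushdown hR S).step p σ ↔ PushdownStep R S p σ y :=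
  Set.Finite.mem_toFinset _

lemma Yields.pushdown_run (hR : R.Finite) {s : List (Symbol T N)} {w : List T}
    (hs : Yields R s w) {p q : pushdownForms R S} (hp : p.1 = s ++ q.1) :
    (pushdown hR S).Run p w 1 q := by
  induction hs generalizing p q with
  | nil =>
    obtain rfl : p = q := Subtype.ext hp
    exact .nil (E := pushdown hR S) p
  | @terminal a s w _ ih =>
    let p' : pushdownForms R S :=
      ⟨s ++ q.1, mem_suffixClosure_of_suffix (hp ▸ List.suffix_cons _ _) p.2⟩
    have hread : (p', 1) ∈ (pushdown hR S).step p (some a) := mem_pushdown_step.2 (.read hp)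
    simpa using GroupAutomaton.Run.step hread (ih rfl)
  | @nonterminal r s u w hr _ _ ih₁ ih₂ =>
    let t : pushdownForms R S :=
      ⟨s ++ q.1, mem_suffixClosure_of_suffix (hp ▸ List.suffix_cons _ _) p.2⟩
    let o : pushdownForms R S := ⟨r.output, output_mem_pushdownForms hr⟩
    let e : pushdownForms R S := ⟨[], nil_mem_pushdownForms⟩
    have hpush : (o, FreeGroup.mk [(t, true)]) ∈ (pushdown hR S).step p none :=
      mem_pushdown_step.2 (.move (hp ▸ .push hr t))
    have hpop : (t, FreeGroup.mk [(t, false)]) ∈ (pushdown hR S).step e none :=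
      mem_pushdown_step.2 (.move (.pop t))
    have hderive : (pushdown hR S).Run o u 1 e := ih₁ (List.append_nil _).symm
    have hcancel : FreeGroup.mk [(t, true)] * FreeGroup.mk [(t, false)] = 1 :=
      mul_inv_cancel (FreeGroup.of t)
    simpa [hcancel] using
      GroupAutomaton.Run.step hpush (hderive.trans (.step hpop (ih₂ (p := t) rfl)))

lemma exists_cutRun_of_pushdown_run {hR : R.Finite} {p q : (pushdown hR S).Q} {w : List T}
    {g : FreeGroup (pushdownForms R S)} (h : (pushdown hR S).Run p w g q) :
    ∃ l, CutRun R p.1 w l q.1 ∧ FreeGroup.mk l = g := by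
  induction h with
  | nil p => exact ⟨[], .nil (s := []) .nil, rfl⟩
  | step hs _ ih =>
    obtain ⟨l, hl, rfl⟩ := ih
    cases mem_pushdown_step.1 hs with
    | read hp =>
      rw [hp, one_mul]
      exact ⟨l, hl.append_left (.terminal _ .nil), rfl⟩
    | @move x _ hx =>
      exact ⟨x :: l, .cons (s := []) .nil hx hl, (FreeGroup.mul_mk (L₁ := [x])).symm⟩

lemma language_pushdown (hR : R.Finite) (S : N) :
    (pushdown hR S).language = yieldLanguage R S := by
  ext w
  rw [GroupAutomaton.mem_language_iff_run]
  constructor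
  · rintro ⟨q, rfl, h⟩
    obtain ⟨l, hcut, hl⟩ := exists_cutRun_of_pushdown_run h
    obtain ⟨l', hll', hl'⟩ := FreeGroup.Red.exact.1 (hl.trans FreeGroup.one_eq_mk)
    rw [FreeGroup.Red.nil_iff.1 hl'] at hll'
    exact (hcut.of_red hll').yields_of_nil
  · exact fun h => ⟨_, rfl, h.pushdown_run hR rfl⟩

end Automaton

end Pushdown

theorem contextFreeClass_subset_languageClass_freeGroup :
    contextFreeClass ⊆ languageClass (FreeGroup ℕ) := by
  intro L hL
  obtain ⟨N, R, S, hR, hRL⟩ := isContextFree_iff_exists_yieldLanguage_eq.1 hL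
  have : Finite (pushdownForms R S) := finite_pushdownForms hR S
  obtain ⟨e, he⟩ := Countable.exists_injective_nat (pushdownForms R S)
  have hpushdown : L ∈ languageClass (FreeGroup (pushdownForms R S)) :=
    ⟨pushdown hR S, (language_pushdown hR S).trans hRL⟩
  exact languageClass_subset_of_injective (FreeGroup.map_injective he) hpushdown

/-! ### A free subgroup of `SL(2,ℤ)` -/

section PingPong

open UpperHalfPlane
open scoped Pointwise Function

/-- The Möbius transformation `z ↦ a - 1 / (z - b)`, which maps the outside of the unit disc centred
at `b` into the unit disc centred at `a`. -/
def discSwap (a b : ℤ) : SLTwoInt :=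
  ModularGroup.T ^ a * ModularGroup.S * ModularGroup.T ^ (-b)

/-- The part in the upper half plane of the closed unit disc centred at the integer `c`. -/
def unitDisc (c : ℤ) : Set ℍ :=
  {z | ‖(z : ℂ) - c‖ ≤ 1}

lemma unitDisc_nonempty (c : ℤ) : (unitDisc c).Nonempty := by
  refine ⟨(c : ℝ) +ᵥ I, ?_⟩
  simp [unitDisc]

lemma disjoint_unitDisc {a b : ℤ} (hab : 2 < |a - b|) : Disjoint (unitDisc a) (unitDisc b) := by
  refine Set.disjoint_left.2 fun z (ha : ‖(z : ℂ) - a‖ ≤ 1) (hb : ‖(z : ℂ) - b‖ ≤ 1) => ?_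
  have hdist : ((|a - b| : ℤ) : ℝ) = ‖((z : ℂ) - b) - ((z : ℂ) - a)‖ := by
    rw [sub_sub_sub_cancel_left, ← Int.cast_sub, Complex.norm_intCast, Int.cast_abs]
  have hle : ((|a - b| : ℤ) : ℝ) ≤ 2 := by
    rw [hdist]
    linarith [norm_sub_le ((z : ℂ) - b) ((z : ℂ) - a)]
  exact hab.not_ge (by exact_mod_cast hle)

lemma coe_discSwap_smul (a b : ℤ) (z : ℍ) :
    ((discSwap a b • z : ℍ) : ℂ) = a - ((z : ℂ) - b)⁻¹ := by
  rw [discSwap, mul_smul, mul_smul, modular_T_zpow_smul, modular_T_zpow_smul, modular_S_smul]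
  simp [← inv_neg, neg_add_eq_sub, sub_eq_add_neg]

lemma discSwap_smul_compl_subset (a b : ℤ) : discSwap a b • (unitDisc b)ᶜ ⊆ unitDisc a := by
  rintro _ ⟨z, hz, rfl⟩
  have hz' : ¬‖(z : ℂ) - b‖ ≤ 1 := hz
  change ‖((discSwap a b • z : ℍ) : ℂ) - a‖ ≤ 1
  rw [coe_discSwap_smul, sub_sub_cancel_left, norm_neg, norm_inv]
  exact inv_le_one_of_one_le₀ (not_le.1 hz').le

lemma inv_smul_compl_subset {G α : Type*} [Group G] [MulAction G α] {g : G} {X Y : Set α}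
    (h : g • Yᶜ ⊆ X) : g⁻¹ • Xᶜ ⊆ Y := by
  rw [Set.smul_set_subset_iff_subset_inv_smul_set, inv_inv, Set.compl_subset_comm,
    ← Set.smul_set_compl]
  exact h

lemma freeGroup_lift_discSwap_injective {ι : Type} [Nontrivial ι] {a b : ι → ℤ}
    (ha : Pairwise fun i j => 2 < |a i - a j|) (hb : Pairwise fun i j => 2 < |b i - b j|)
    (hab : ∀ i j, 2 < |a i - b j|) :
    Function.Injective (FreeGroup.lift fun i => discSwap (a i) (b i)) := by
  refine FreeGroup.injective_lift_of_ping_pong (fun i => discSwap (a i) (b i))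
    (fun i => unitDisc (a i)) (fun i => unitDisc (b i)) (fun i => unitDisc_nonempty (a i))
    (fun i j hij => ?_) (fun i j hij => ?_) (fun i j => ?_) (fun i => ?_) (fun i => ?_)
  · exact disjoint_unitDisc (ha hij)
  · exact disjoint_unitDisc (hb hij)
  · exact disjoint_unitDisc (hab i j)
  · exact discSwap_smul_compl_subset (a i) (b i)
  · exact inv_smul_compl_subset (discSwap_smul_compl_subset (a i) (b i))

lemma exists_injective_freeGroup_nat_SLTwoInt :
    ∃ f : FreeGroup ℕ →* SLTwoInt, Function.Injective f := by
  refine ⟨_, freeGroup_lift_discSwap_injective (a := fun n : ℕ => 6 * (n : ℤ))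
    (b := fun n : ℕ => 6 * (n : ℤ) + 3) (fun m n hmn => ?_) (fun m n hmn => ?_) fun m n => ?_⟩
  all_goals simp only [lt_abs]; omega

end PingPong

theorem contextFreeClass_subset_languageClass_SLTwoInt :
    contextFreeClass ⊆ languageClass SLTwoInt := by
  obtain ⟨f, hf⟩ := exists_injective_freeGroup_nat_SLTwoInt
  exact contextFreeClass_subset_languageClass_freeGroup.trans (languageClass_subset_of_injective hf)

/-! ### Automata over groups with triangulable closed paths -/

namespace GroupAutomaton

section Refine

variable {A G : Type} [Group G]

/-- The elements of `G` by which the transitions of `E` multiply the register. -/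
def labels (E : GroupAutomaton A G) : Set G :=
  {g | ∃ q σ q', (q', g) ∈ E.step q σ}

lemma finite_labels [Finite A] (E : GroupAutomaton A G) : E.labels.Finite := by
  have := E.finite_Q
  refine (Set.finite_iUnion fun y : E.Q × Option A =>
    ((E.step y.1 y.2).finite_toSet.image Prod.snd)).subset ?_
  rintro g ⟨q, σ, q', hs⟩
  exact Set.mem_iUnion.2 ⟨(q, σ), (q', g), hs, rfl⟩

/-- The words that `refine` still has to multiply into the register, with the factors taken from the
words `word g` of the labels `g` of `E`. -/
def pendingWords (E : GroupAutomaton A G) (word : G → List G) : Set (List G) :=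
  suffixClosure (insert [] (word '' E.labels))

variable {E : GroupAutomaton A G} {word : G → List G}

lemma finite_pendingWords [Finite A] : (E.pendingWords word).Finite :=
  finite_suffixClosure ((E.finite_labels.image word).insert [])

lemma nil_mem_pendingWords : [] ∈ E.pendingWords word :=
  subset_suffixClosure (Set.mem_insert _ _)

lemma word_mem_pendingWords {q q' : E.Q} {σ : Option A} {g : G} (hs : (q', g) ∈ E.step q σ) :
    word g ∈ E.pendingWords word :=
  subset_suffixClosure (Set.mem_insert_of_mem _ ⟨g, ⟨q, σ, q', hs⟩, rfl⟩)

/-- The transitions of `refine`: a transition of `E` with label `g` loads `word g`, and the letters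
loaded are multiplied into the register one after the other. -/
inductive RefineStep (E : GroupAutomaton A G) (word : G → List G) :
    E.Q × E.pendingWords word → Option A → (E.Q × E.pendingWords word) × G → Prop
  | load {q q' : E.Q} {σ : Option A} {g : G} {u v : E.pendingWords word}
      (hs : (q', g) ∈ E.step q σ) (hu : u.1 = []) (hv : v.1 = word g) :
      RefineStep E word (q, u) σ ((q', v), 1)
  | multiply {q : E.Q} {d : G} {u v : E.pendingWords word} (hu : u.1 = d :: v.1) :
      RefineStep E word (q, u) none ((q, v), d)

lemma finite_setOf_refineStep [Finite A] (p : E.Q × E.pendingWords word) (σ : Option A) :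
    {y | RefineStep E word p σ y}.Finite := by
  have := E.finite_Q
  have : Finite (E.pendingWords word) := finite_pendingWords
  have hletters : (⋃ u ∈ E.pendingWords word, {d | d ∈ u}).Finite :=
    finite_pendingWords.biUnion fun u _ => List.finite_toSet u
  refine (Set.finite_univ.prod (hletters.insert 1)).subset ?_
  rintro _ (⟨-, -, -⟩ | @⟨_, d, u, _, hu⟩)
  · exact ⟨Set.mem_univ _, Set.mem_insert _ _⟩
  · refine ⟨Set.mem_univ _, Set.mem_insert_of_mem _ (Set.mem_biUnion u.2 ?_)⟩
    exact hu ▸ List.mem_cons_self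

/-- The automaton `E` with each label `g` spelled out as the word `word g`. -/
noncomputable def refine [Finite A] (E : GroupAutomaton A G) (word : G → List G) :
    GroupAutomaton A G where
  Q := E.Q × E.pendingWords word
  finite_Q := by
    have := E.finite_Q
    have : Finite (E.pendingWords word) := finite_pendingWords
    infer_instance
  step p σ := (finite_setOf_refineStep p σ).toFinset
  start := (E.start, ⟨[], nil_mem_pendingWords⟩)
  accept := {p | p.1 ∈ E.accept ∧ p.2.1 = []}

variable [Finite A]

lemma mem_refine_step {p : E.Q × E.pendingWords word} {σ : Option A}
    {y : (E.Q × E.pendingWords word) × G} :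
    y ∈ (E.refine word).step p σ ↔ RefineStep E word p σ y :=
  Set.Finite.mem_toFinset _

lemma refine_run_pendingWord (q : E.Q) {u v : E.pendingWords word} (hv : v.1 = []) :
    (E.refine word).Run (q, u) [] u.1.prod (q, v) := by
  obtain ⟨u, hu⟩ := u
  induction u with
  | nil =>
    obtain rfl : ⟨[], hu⟩ = v := Subtype.ext hv.symm
    exact .nil (E := E.refine word) (q, _)
  | cons d u ih =>
    rw [List.prod_cons]
    have hu' := mem_suffixClosure_of_suffix (List.suffix_cons d u) hu
    exact .step (E := E.refine word) (σ := none)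
      (mem_refine_step.2 (.multiply (v := ⟨u, hu'⟩) rfl)) (ih hu')

lemma Run.refine (hword : ∀ g, (word g).prod = g) {q q' : E.Q} {w : List A} {g : G}
    (hr : E.Run q w g q') {u v : E.pendingWords word} (hu : u.1 = []) (hv : v.1 = []) :
    (E.refine word).Run (q, u) w g (q', v) := by
  induction hr generalizing u with
  | nil q =>
    obtain rfl : u = v := Subtype.ext (hu.trans hv.symm)
    exact .nil (E := E.refine word) (q, u)
  | @step q q' q'' σ g h w hs _ ih =>
    let t : E.pendingWords word := ⟨word g, word_mem_pendingWords hs⟩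
    have hload : ((q', t), 1) ∈ (E.refine word).step (q, u) σ :=
      mem_refine_step.2 (.load hs hu rfl)
    have hmultiply : (E.refine word).Run (q', t) [] g (q', u) := by
      have hrun := refine_run_pendingWord q' (u := t) hu
      rwa [show t.1.prod = g from hword g] at hrun
    simpa using Run.step hload (hmultiply.trans (ih hu))

lemma Run.exists_of_refine (hword : ∀ g, (word g).prod = g) {p p' : (E.refine word).Q}
    {w : List A} {g : G} (hr : (E.refine word).Run p w g p') (hp' : p'.2.1 = []) :
    ∃ h, E.Run p.1 w h p'.1 ∧ p.2.1.prod * h = g := by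
  induction hr with
  | nil p => exact ⟨1, .nil (E := E) p.1, by rw [hp', List.prod_nil, one_mul]⟩
  | step hs _ ih =>
    obtain ⟨h, hr, rfl⟩ := ih hp'
    cases mem_refine_step.1 hs with
    | @load _ _ _ g _ _ hs' hu hv =>
      refine ⟨g * h, .step hs' hr, ?_⟩
      rw [hu, hv, hword, List.prod_nil, one_mul]
    | multiply hu => exact ⟨h, hr, by rw [hu, List.prod_cons, mul_assoc]⟩

lemma language_refine (hword : ∀ g, (word g).prod = g) :
    (E.refine word).language = E.language := by
  ext w
  rw [mem_language_iff_run, mem_language_iff_run]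
  constructor
  · rintro ⟨p, ⟨hp, hp'⟩, hr⟩
    obtain ⟨h, hr, hh⟩ := hr.exists_of_refine hword hp'
    obtain rfl : h = 1 := (one_mul h).symm.trans hh
    exact ⟨p.1, hp, hr⟩
  · rintro ⟨q, hq, hr⟩
    exact ⟨(q, ⟨[], nil_mem_pendingWords⟩), ⟨hq, rfl⟩, hr.refine hword rfl rfl⟩

lemma labels_refine_subset {D : Set G} (hone : 1 ∈ D) (hword : ∀ g, ∀ d ∈ word g, d ∈ D) :
    (E.refine word).labels ⊆ D := by
  rintro d ⟨p, σ, p', hs⟩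
  obtain _ | @⟨q, d, ⟨_, l, hl, hul⟩, v, rfl⟩ := mem_refine_step.1 hs
  · exact hone
  · have hd : d ∈ l := hul.mem List.mem_cons_self
    rcases hl with rfl | ⟨g, -, rfl⟩
    · exact absurd hd List.not_mem_nil
    · exact hword g d hd

lemma exists_language_eq_labels_subset {D : Set G} (hone : 1 ∈ D)
    (hD : Submonoid.closure D = ⊤) (E : GroupAutomaton A G) :
    ∃ E' : GroupAutomaton A G, E'.language = E.language ∧ E'.labels ⊆ D := by
  choose word hmem hprod using fun g : G =>
    Submonoid.exists_list_of_mem_closure (hD ▸ Submonoid.mem_top g)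
  exact ⟨E.refine word, language_refine hprod, labels_refine_subset hone hmem⟩

end Refine

end GroupAutomaton

/-- A set `D` of group elements triangulates the closed paths in the Cayley graph: `D` generates `G`
as a monoid, and a word of length at least two over `D` that represents `1` has two consecutive
letters whose product is in `D`, so that it can be shortened without leaving `D`. -/
structure IsTriangulating {G : Type*} [Group G] (D : Set G) : Prop where
  one_mem : 1 ∈ D
  closure_eq_top : Submonoid.closure D = ⊤
  exists_mul_mem (l : List D) (hlen : 2 ≤ l.length) (hprod : (l.map Subtype.val).prod = 1) :
    ∃ (l₁ : List D) (c d : D) (l₂ : List D), l = l₁ ++ c :: d :: l₂ ∧ (c * d : G) ∈ D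

namespace GroupAutomaton

section Triangle

variable {A G : Type} [Group G] {E : GroupAutomaton A G} {D : Set G}

/-- The nonterminals of the grammar `TriangleRule`: `some (p, d, q)` stands for the words read by
the computations from `p` to `q` that multiply the register by `d`, and `none` for the language of
the automaton. -/
abbrev Triple (E : GroupAutomaton A G) (D : Set G) : Type :=
  Option (E.Q × D × E.Q)

/-- The rules of a grammar that composes computations of `E` from single transitions, as long as the
register is multiplied by an element of `D`. -/
inductive TriangleRule (E : GroupAutomaton A G) (D : Set G) :
    ContextFreeRule A (E.Triple D) → Prop
  | accept {q : E.Q} {d : D} (hq : q ∈ E.accept) (hd : (d : G) = 1) :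
      TriangleRule E D ⟨none, [.nonterminal (some (E.start, d, q))]⟩
  | refl (q : E.Q) {d : D} (hd : (d : G) = 1) : TriangleRule E D ⟨some (q, d, q), []⟩
  | step {q q' : E.Q} {σ : Option A} {d : D} (hs : (q', (d : G)) ∈ E.step q σ) :
      TriangleRule E D ⟨some (q, d, q'), σ.toList.map .terminal⟩
  | trans (p q r : E.Q) {c d e : D} (he : (c * d : G) = e) :
      TriangleRule E D
        ⟨some (p, e, r), [.nonterminal (some (p, c, q)), .nonterminal (some (q, d, r))]⟩

lemma finite_setOf_triangleRule [Finite A] (hD : D.Finite) : {r | TriangleRule E D r}.Finite := by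
  have := E.finite_Q
  have : Finite D := hD
  have : Finite (Symbol A (E.Triple D)) :=
    .of_surjective (Sum.elim Symbol.terminal Symbol.nonterminal) <| by
      rintro (a | N)
      exacts [⟨.inl a, rfl⟩, ⟨.inr N, rfl⟩]
  refine ((Set.finite_univ.prod (List.finite_length_le (Symbol A (E.Triple D)) 2)).image
    fun y => ⟨y.1, y.2⟩).subset fun r hr => ⟨(r.input, r.output), ⟨Set.mem_univ _, ?_⟩, rfl⟩
  cases hr with
  | @step _ _ σ => cases σ <;> simp
  | _ => simp

/-- The languages for which the nonterminals of `TriangleRule` stand. -/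
def tripleLanguage (E : GroupAutomaton A G) (D : Set G) : E.Triple D → Language A
  | none => E.language
  | some (p, d, q) => {w | E.Run p w d q}

lemma mem_tripleLanguage_of_triangleRule {r : ContextFreeRule A (E.Triple D)} {w : List A}
    (hr : TriangleRule E D r) (hw : w ∈ formLanguage (E.tripleLanguage D) r.output) :
    w ∈ E.tripleLanguage D r.input := by
  cases hr with
  | @accept q d hq hd =>
    have hw' : w ∈ E.tripleLanguage D (some (E.start, d, q)) := by simpa [formLanguage] using hw
    have hrun : E.Run E.start w d q := hw'
    exact mem_language_iff_run.2 ⟨q, hq, hd ▸ hrun⟩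
  | @refl q d hd =>
    obtain rfl : w = [] := hw
    change E.Run q [] d q
    rw [hd]
    exact .nil q
  | @step q q' σ d hs =>
    obtain rfl : w = σ.toList := by
      cases σ with
      | none => exact hw
      | some a =>
        have hw' : w ∈ ({[a]} : Language A) := by simpa [formLanguage] using hw
        exact hw'
    exact Run.of_mem_step hs
  | @trans p q r c d e he =>
    have hw' : w ∈ E.tripleLanguage D (some (p, c, q)) * E.tripleLanguage D (some (q, d, r)) := by
      simpa [formLanguage] using hw
    obtain ⟨u, hu, v, hv, rfl⟩ := Language.mem_mul.1 hw'
    have hrun : E.Run p (u ++ v) (c * d) r := Run.trans hu hv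
    change E.Run p (u ++ v) e r
    rwa [← he]

/-- `E.Path D p w l q`: the word `w` is read on the way from `p` to `q` by successive computations
that `TriangleRule` derives and that multiply the register by the entries of `l`. -/
inductive Path (E : GroupAutomaton A G) (D : Set G) : E.Q → List A → List D → E.Q → Prop
  | nil (q : E.Q) : Path E D q [] [] q
  | cons {p q r : E.Q} {u v : List A} {d : D} {l : List D}
      (hd : Yields {r | TriangleRule E D r} [.nonterminal (some (p, d, q))] u)
      (hl : Path E D q v l r) : Path E D p (u ++ v) (d :: l) r

lemma Path.merge {p q : E.Q} {w : List A} {l₁ l₂ : List D} {c d e : D} (he : (c * d : G) = e)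
    (h : E.Path D p w (l₁ ++ c :: d :: l₂) q) : E.Path D p w (l₁ ++ e :: l₂) q := by
  induction l₁ generalizing p w with
  | nil =>
    obtain _ | ⟨hc, _ | ⟨hd, hl⟩⟩ := h
    rw [← List.append_assoc]
    exact .cons (.of_mem (TriangleRule.trans _ _ _ he) (hc.append hd)) hl
  | cons b l₁ ih =>
    obtain _ | ⟨hb, hl⟩ := h
    exact .cons hb (ih hl)

lemma Path.yields (hD : IsTriangulating D) {p q : E.Q} {w : List A} {l : List D} {e : D}
    (h : E.Path D p w l q) (hl : (l.map Subtype.val).prod = 1) (he : (e : G) = 1) :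
    Yields {r | TriangleRule E D r} [.nonterminal (some (p, e, q))] w := by
  induction hn : l.length using Nat.strong_induction_on generalizing l with
  | _ n ih =>
    subst hn
    match l with
    | [] =>
      cases h
      exact .of_mem (TriangleRule.refl _ he) .nil
    | [d] =>
      obtain _ | ⟨hd, _ | _⟩ := h
      obtain rfl : d = e := Subtype.ext (by simpa [he] using hl)
      rwa [List.append_nil]
    | a :: b :: l =>
      obtain ⟨l₁, c, d, l₂, hsplit, hcd⟩ := hD.exists_mul_mem (a :: b :: l) (by simp) hl
      rw [hsplit] at h hl ih
      refine ih _ (by simp) (Path.merge (e := ⟨(c : G) * d, hcd⟩) rfl h) ?_ rfl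
      simpa [mul_assoc] using hl

lemma Run.exists_path (hD : E.labels ⊆ D) {p q : E.Q} {w : List A} {g : G}
    (hr : E.Run p w g q) : ∃ l : List D, (l.map Subtype.val).prod = g ∧ E.Path D p w l q := by
  induction hr with
  | nil q => exact ⟨[], rfl, .nil q⟩
  | @step p q _ σ d _ _ hs _ ih =>
    obtain ⟨l, rfl, hl⟩ := ih
    have hd : d ∈ D := hD ⟨p, σ, q, hs⟩
    have hyields := Yields.of_mem (TriangleRule.step (d := ⟨d, hd⟩) hs) (.map_terminal σ.toList)
    exact ⟨⟨d, hd⟩ :: l, by simp, .cons hyields hl⟩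

lemma yieldLanguage_triangleRule (hD : IsTriangulating D) (hE : E.labels ⊆ D) :
    yieldLanguage {r | TriangleRule E D r} none = E.language := by
  ext w
  constructor
  · intro h
    simpa [formLanguage, tripleLanguage] using
      h.mem_formLanguage (L := E.tripleLanguage D) fun _ hr _ =>
        mem_tripleLanguage_of_triangleRule hr
  · intro h
    obtain ⟨q, hq, hr⟩ := mem_language_iff_run.1 h
    obtain ⟨l, hl, hpath⟩ := hr.exists_path hE
    let e : D := ⟨1, hD.one_mem⟩
    exact .of_mem (TriangleRule.accept (d := e) hq rfl) (hpath.yields hD hl rfl)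

end Triangle

theorem isContextFree_language_of_isTriangulating {A G : Type} [Finite A] [Group G] {D : Set G}
    (hD : IsTriangulating D) (hfin : D.Finite) (E : GroupAutomaton A G) :
    E.language.IsContextFree := by
  obtain ⟨E', hE', hlabels⟩ := exists_language_eq_labels_subset hD.one_mem hD.closure_eq_top E
  exact isContextFree_iff_exists_yieldLanguage_eq.2
    ⟨E'.Triple D, _, none, finite_setOf_triangleRule hfin,
      (yieldLanguage_triangleRule hD hlabels).trans hE'⟩

end GroupAutomaton

section SLTwoIntTriangulating

open UpperHalfPlane
open ModularGroup (S T)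

/-- The elements of `SL(2,ℤ)` of order `4` in the factor `⟨S⟩` of the amalgamated product
`⟨S⟩ *_{±1} ⟨TS⟩`. -/
def orderFourPart : Finset SLTwoInt :=
  {S, -S}

/-- The elements of `SL(2,ℤ)` outside `{1, -1}` in the factor `⟨TS⟩` of the amalgamated product
`⟨S⟩ *_{±1} ⟨TS⟩`. -/
def orderSixPart : Finset SLTwoInt :=
  {T * S, -(T * S), S * T⁻¹, -(S * T⁻¹)}

/-- The union of the factors of the amalgamated product `SL(2,ℤ) = ⟨S⟩ *_{±1} ⟨TS⟩`. -/
def factors : Finset SLTwoInt :=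
  {1, -1} ∪ orderFourPart ∪ orderSixPart

/-- The elements `x` and `y` lie in different factors of `⟨S⟩ *_{±1} ⟨TS⟩`, outside the amalgamated
subgroup `{1, -1}`. -/
def Alternate (x y : SLTwoInt) : Prop :=
  x ∈ orderFourPart ∧ y ∈ orderSixPart ∨ x ∈ orderSixPart ∧ y ∈ orderFourPart

lemma disjoint_orderFourPart_orderSixPart : Disjoint orderFourPart orderSixPart := by
  decide

lemma alternate_of_mul_notMem_factors {x y : SLTwoInt} (hx : x ∈ factors) (hy : y ∈ factors)
    (hxy : x * y ∉ factors) : Alternate x y := by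
  have key : ∀ x ∈ factors, ∀ y ∈ factors, x * y ∉ factors →
      x ∈ orderFourPart ∧ y ∈ orderSixPart ∨ x ∈ orderSixPart ∧ y ∈ orderFourPart := by decide
  exact key x hx y hy hxy

lemma submonoid_closure_factors : Submonoid.closure (factors : Set SLTwoInt) = ⊤ := by
  have hS : S ∈ Subgroup.closure (factors : Set SLTwoInt) :=
    Subgroup.subset_closure (Finset.mem_coe.2 (by decide))
  have hTS : T * S ∈ Subgroup.closure (factors : Set SLTwoInt) :=
    Subgroup.subset_closure (Finset.mem_coe.2 (by decide))
  have htop : Subgroup.closure (factors : Set SLTwoInt) = ⊤ := by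
    rw [eq_top_iff, ← SpecialLinearGroup.SL2Z_generators, Subgroup.closure_le]
    rintro _ (rfl | rfl)
    exacts [hS, (Subgroup.mul_mem_cancel_right _ hS).1 hTS]
  have hinv : (factors : Set SLTwoInt)⁻¹ ⊆ factors := fun x hx =>
    inv_inv x ▸ (by decide : ∀ y ∈ factors, y⁻¹ ∈ factors) x⁻¹ hx
  rw [← Set.union_eq_left.2 hinv, ← Subgroup.closure_toSubmonoid, htop, Subgroup.top_toSubmonoid]

lemma re_S_smul (z : ℍ) : (S • z).re = -z.re / Complex.normSq z := by
  rw [modular_S_smul, ← coe_re, coe_mk, Complex.inv_re, Complex.normSq_neg, Complex.neg_re, coe_re]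

lemma re_smul_of_mem_orderFourPart {x : SLTwoInt} (hx : x ∈ orderFourPart) (z : ℍ) :
    (x • z).re = -z.re / Complex.normSq z := by
  obtain rfl | rfl := by simpa [orderFourPart] using hx
  · exact re_S_smul z
  · rw [ModularGroup.SL_neg_smul, re_S_smul]

lemma re_smul_pos_of_mem_orderSixPart {x : SLTwoInt} (hx : x ∈ orderSixPart) {z : ℍ}
    (hz : z.re ≤ 0) : 0 < (x • z).re := by
  have hTS : 0 < ((T * S) • z).re := by
    rw [mul_smul, modular_T_smul, vadd_re, re_S_smul]
    have := div_nonneg (neg_nonneg.2 hz) (normSq_pos z).le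
    linarith
  have hST : 0 < ((S * T⁻¹) • z).re := by
    have hT : (T⁻¹ • z).re = -1 + z.re := by
      simpa using congrArg re (modular_T_zpow_smul z (-1))
    rw [mul_smul, re_S_smul, hT]
    exact div_pos (by linarith) (normSq_pos _)
  obtain rfl | rfl | rfl | rfl := by simpa [orderSixPart] using hx
  exacts [hTS, by rwa [ModularGroup.SL_neg_smul], hST, by rwa [ModularGroup.SL_neg_smul]]

lemma re_prod_smul_I {x : SLTwoInt} {l : List SLTwoInt} (h : (x :: l).IsChain Alternate) :
    (x ∈ orderSixPart → 0 < ((x :: l).prod • I).re) ∧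
      (x ∈ orderFourPart →
        ((x :: l).prod • I).re ≤ 0 ∧ (l ≠ [] → ((x :: l).prod • I).re < 0)) := by
  induction l generalizing x with
  | nil =>
    rw [List.prod_singleton]
    refine ⟨fun hx => re_smul_pos_of_mem_orderSixPart hx I_re.le, fun hx => ⟨?_, by simp⟩⟩
    rw [re_smul_of_mem_orderFourPart hx, I_re, neg_zero, zero_div]
  | cons y l ih =>
    obtain ⟨hxy, hl⟩ := List.isChain_cons_cons.1 h
    obtain ⟨hsix, hfour⟩ := ih hl
    rw [List.prod_cons, mul_smul]
    obtain ⟨hx, hy⟩ | ⟨hx, hy⟩ := hxy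
    · have hneg : (x • (y :: l).prod • I).re < 0 := by
        rw [re_smul_of_mem_orderFourPart hx]
        exact div_neg_of_neg_of_pos (neg_neg_of_pos (hsix hy)) (normSq_pos _)
      exact ⟨fun hx' => absurd hx (Finset.disjoint_right.1 disjoint_orderFourPart_orderSixPart hx'),
        fun _ => ⟨hneg.le, fun _ => hneg⟩⟩
    · have hpos := re_smul_pos_of_mem_orderSixPart hx (hfour hy).1
      exact ⟨fun _ => hpos,
        fun hx' => absurd hx (Finset.disjoint_left.1 disjoint_orderFourPart_orderSixPart hx')⟩

lemma prod_ne_one_of_isChain_alternate {l : List SLTwoInt} (hlen : 2 ≤ l.length)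
    (h : l.IsChain Alternate) : l.prod ≠ 1 := by
  match l with
  | x :: y :: l =>
    intro hprod
    obtain ⟨hsix, hfour⟩ := re_prod_smul_I h
    rw [hprod, one_smul, I_re] at hsix hfour
    obtain ⟨hx, -⟩ | ⟨hx, -⟩ := (List.isChain_cons_cons.1 h).1
    · exact lt_irrefl _ ((hfour hx).2 (List.cons_ne_nil _ _))
    · exact lt_irrefl _ (hsix hx)

theorem isTriangulating_factors : IsTriangulating (factors : Set SLTwoInt) where
  one_mem := Finset.mem_coe.2 (by decide)
  closure_eq_top := submonoid_closure_factors
  exists_mul_mem l hlen hprod := by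
    by_contra! hreduced
    have hchain : l.IsChain fun c d : (factors : Set SLTwoInt) => Alternate c d :=
      List.isChain_iff_forall_rel_of_append_cons_cons.2 fun c d l₁ l₂ hl =>
        alternate_of_mul_notMem_factors c.2 d.2 (hreduced l₁ c d l₂ hl)
    exact prod_ne_one_of_isChain_alternate (by simpa using hlen)
      ((List.isChain_map _).2 hchain) hprod

end SLTwoIntTriangulating

theorem languageClass_SLTwoInt_eq_contextFreeClass :
    languageClass SLTwoInt = contextFreeClass := by
  refine Set.Subset.antisymm ?_ contextFreeClass_subset_languageClass_SLTwoInt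
  rintro L ⟨E, hE⟩
  have := L.finite_alphabet
  change L.words.IsContextFree
  exact hE ▸ E.isContextFree_language_of_isTriangulating isTriangulating_factors
    factors.finite_toSet

/-! ### Unary context-free languages -/

section UnaryContextFree

variable {T N : Type*} {R R₀ : Set (ContextFreeRule T N)} {s : List (Symbol T N)} {A : N}
  {w : List T} {k : ℕ}

/-- The lengths of the words that the sentential form `s` derives by the rules in `R`. -/
def yieldLengths (R : Set (ContextFreeRule T N)) (s : List (Symbol T N)) : Set ℕ :=
  List.length '' {w | Yields R s w}

lemma Yields.length_mem_yieldLengths (h : Yields R s w) : w.length ∈ yieldLengths R s :=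
  ⟨w, h, rfl⟩

lemma add_mem_yieldLengths_cons {m n : ℕ} (hm : m ∈ yieldLengths R [.nonterminal A])
    (hn : n ∈ yieldLengths R s) : m + n ∈ yieldLengths R (.nonterminal A :: s) := by
  obtain ⟨u, hu, rfl⟩ := hm
  obtain ⟨v, hv, rfl⟩ := hn
  exact ⟨u ++ v, Yields.append hu hv, List.length_append⟩

/-- The sentential form `s` derives forms with one occurrence of `A` and otherwise terminals, `k` of
them, as far as lengths can tell: each length that `A` yields gives, increased by `k`, a length that
`s` yields. -/
def IsContextLength (R : Set (ContextFreeRule T N)) (s : List (Symbol T N)) (A : N) (k : ℕ) :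
    Prop :=
  ∀ n ∈ yieldLengths R [.nonterminal A], k + n ∈ yieldLengths R s

lemma IsContextLength.mul (h : IsContextLength R [.nonterminal A] A k) (i : ℕ) :
    IsContextLength R [.nonterminal A] A (k * i) := by
  induction i with
  | zero => simp [IsContextLength]
  | succ i ih =>
    intro n hn
    rw [Nat.mul_succ, add_comm (k * i), add_assoc]
    exact h _ (ih n hn)

lemma IsContextLength.terminal_cons (h : IsContextLength R s A k) (a : T) :
    IsContextLength R (.terminal a :: s) A (k + 1) := by
  intro n hn
  obtain ⟨w, hw, hlen⟩ := h n hn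
  exact ⟨a :: w, .terminal a hw, by rw [List.length_cons, hlen, add_right_comm]⟩

lemma IsContextLength.nonterminal_cons {B : N} {m : ℕ} (h : IsContextLength R s A k)
    (hm : m ∈ yieldLengths R [.nonterminal B]) :
    IsContextLength R (.nonterminal B :: s) A (m + k) := by
  intro n hn
  rw [add_assoc]
  exact add_mem_yieldLengths_cons hm (h n hn)

lemma IsContextLength.output_append {r : ContextFreeRule T N} (hr : r ∈ R) {m : ℕ}
    (h : IsContextLength R r.output A k) (hm : m ∈ yieldLengths R s) :
    IsContextLength R (.nonterminal r.input :: s) A (k + m) := by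
  intro n hn
  obtain ⟨w, hw, hlen⟩ := h n hn
  rw [add_right_comm, ← hlen]
  exact add_mem_yieldLengths_cons ⟨w, .of_mem hr hw, rfl⟩ hm

lemma isContextLength_cons {m : ℕ} (hm : m ∈ yieldLengths R s) :
    IsContextLength R (.nonterminal A :: s) A m := by
  intro n hn
  rw [add_comm]
  exact add_mem_yieldLengths_cons hn hm

/-- In a parse forest that meets `W`, a subtree that is minimal among those with root in `W` has no
other node in `W`. -/
lemma Yields.avoids_or_exists_isContextLength (hR : R ⊆ R₀) (W : Set N) (h : Yields R s w) :
    Yields {r ∈ R | r.input ∉ W} s w ∨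
      ∃ r ∈ R, r.input ∈ W ∧ ∃ k v, Yields {r ∈ R | r.input ∉ W} r.output v ∧
        IsContextLength R₀ s r.input k ∧ w.length = k + v.length := by
  induction h with
  | nil => exact .inl .nil
  | terminal a _ ih =>
    obtain h | ⟨r, hr, hW, k, v, hv, hk, hlen⟩ := ih
    · exact .inl (.terminal a h)
    · exact .inr ⟨r, hr, hW, k + 1, v, hv, hk.terminal_cons a,
        by rw [List.length_cons, hlen, add_right_comm]⟩
  | @nonterminal r s u w hr h₁ h₂ ih₁ ih₂ =>
    rw [List.length_append]
    have hu := ((of_mem hr h₁).mono hR).length_mem_yieldLengths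
    have hw := (h₂.mono hR).length_mem_yieldLengths
    obtain h₁ | ⟨r', hr', hW, k, v, hv, hk, hlen⟩ := ih₁
    · by_cases hW : r.input ∈ W
      · exact .inr ⟨r, hr, hW, w.length, u, h₁, isContextLength_cons hw, add_comm _ _⟩
      obtain h₂ | ⟨r', hr', hW', k, v, hv, hk, hlen⟩ := ih₂
      · exact .inl (.nonterminal ⟨hr, hW⟩ h₁ h₂)
      · exact .inr ⟨r', hr', hW', u.length + k, v, hv, hk.nonterminal_cons hu,
          by rw [hlen, add_assoc]⟩
    · exact .inr ⟨r', hr', hW, k + w.length, v, hv, hk.output_append (hR hr) hw,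
        by rw [hlen, add_right_comm]⟩

/-- No parse tree with root `A` has a further node `A` below which it can be pumped. -/
def IsAperiodic (R : Set (ContextFreeRule T N)) (A : N) : Prop :=
  ∀ k, IsContextLength R [.nonterminal A] A k → k = 0

lemma Yields.length_le_mul {C : ℕ} (hC : ∀ r ∈ R, ∀ w, Yields R [.nonterminal r.input] w →
    w.length ≤ C) (h : Yields R s w) : w.length ≤ (C + 1) * s.length := by
  induction h with
  | nil => exact Nat.zero_le _
  | terminal a _ ih =>
    rw [List.length_cons, List.length_cons, Nat.mul_succ]
    omega
  | nonterminal hr h₁ _ _ ih =>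
    have := hC _ hr _ (.of_mem hr h₁)
    rw [List.length_append, List.length_cons, Nat.mul_succ]
    omega

lemma IsAperiodic.exists_length_le (hA : IsAperiodic R₀ A) (hR : R ⊆ R₀) (hfin : R.Finite) {B : ℕ}
    (hB : ∀ s w, Yields {r ∈ R | r.input ∉ ({A} : Set N)} s w → w.length ≤ B * s.length) :
    ∃ C, ∀ w, Yields R [.nonterminal A] w → w.length ≤ C := by
  obtain ⟨M, hM⟩ := (hfin.image fun r => r.output.length).bddAbove
  refine ⟨B * M, fun w hw => ?_⟩
  obtain h | ⟨r, hr, rfl, k, v, hv, hk, hlen⟩ := hw.avoids_or_exists_isContextLength hR {A}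
  · cases h with
    | nonterminal hr => exact absurd rfl hr.2
  · obtain rfl := hA k hk
    rw [hlen, zero_add]
    exact (hB _ _ hv).trans (Nat.mul_le_mul_left B (hM (Set.mem_image_of_mem _ hr)))

lemma exists_length_le_mul_of_isAperiodic (hfin : R.Finite) (hR : R ⊆ R₀)
    (hap : ∀ r ∈ R, IsAperiodic R₀ r.input) :
    ∃ B, ∀ s w, Yields R s w → w.length ≤ B * s.length := by
  induction hn : (ContextFreeRule.input '' R).ncard using Nat.strong_induction_on
    generalizing R with
  | _ n ih =>
    have hroot : ∀ r ∈ R, ∃ C, ∀ w, Yields R [.nonterminal r.input] w → w.length ≤ C := by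
      intro r hr
      have hss : {r' ∈ R | r'.input ∉ ({r.input} : Set N)} ⊆ R := Set.sep_subset _ _
      have hlt :
          (ContextFreeRule.input '' {r' ∈ R | r'.input ∉ ({r.input} : Set N)}).ncard < n := by
        refine hn ▸ Set.ncard_lt_ncard ⟨Set.image_mono hss, fun h => ?_⟩ (hfin.image _)
        obtain ⟨r', hr', heq⟩ := h (Set.mem_image_of_mem _ hr)
        exact hr'.2 heq
      obtain ⟨B, hB⟩ := ih _ hlt (hfin.subset hss) (hss.trans hR) (fun r' hr' => hap r' hr'.1) rfl
      exact (hap r hr).exists_length_le hR hfin hB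
    choose! C hC using hroot
    obtain ⟨M, hM⟩ := (hfin.image C).bddAbove
    exact ⟨M + 1, fun s w h => h.length_le_mul fun r hr w hw =>
      (hC r hr w hw).trans (hM (Set.mem_image_of_mem C hr))⟩

lemma exists_common_period (hfin : R.Finite) :
    ∃ P > 0, ∀ r ∈ R, ¬IsAperiodic R r.input →
      IsContextLength R [.nonterminal r.input] r.input P := by
  classical
  have hperiod (A : N) :
      ∃ k > 0, ¬IsAperiodic R A → IsContextLength R [.nonterminal A] A k := by
    by_cases hA : IsAperiodic R A
    · exact ⟨1, one_pos, fun h => absurd hA h⟩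
    · obtain ⟨k, hk, hk0⟩ : ∃ k, IsContextLength R [.nonterminal A] A k ∧ k ≠ 0 := by
        simpa [IsAperiodic] using hA
      exact ⟨k, Nat.pos_of_ne_zero hk0, fun _ => hk⟩
  choose period hpos hperiod using hperiod
  refine ⟨∏ r ∈ hfin.toFinset, period r.input, Finset.prod_pos fun r _ => hpos r.input,
    fun r hr hper => ?_⟩
  obtain ⟨i, hi⟩ := Finset.dvd_prod_of_mem (fun r => period r.input) (hfin.mem_toFinset.2 hr)
  exact hi ▸ (hperiod r.input hper).mul i

theorem exists_eventually_add_mem_yieldLengths (hfin : R.Finite) (s : List (Symbol T N)) :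
    ∃ P > 0, ∀ᶠ n in Filter.atTop, n ∈ yieldLengths R s → n + P ∈ yieldLengths R s := by
  obtain ⟨P, hP, hperiod⟩ := exists_common_period hfin
  obtain ⟨B, hB⟩ := exists_length_le_mul_of_isAperiodic (R₀ := R)
    (hfin.subset (Set.sep_subset R fun r => r.input ∉ {A | ¬IsAperiodic R A}))
    (Set.sep_subset _ _) fun r hr => not_not.1 hr.2
  refine ⟨P, hP, Filter.eventually_atTop.2 ⟨B * s.length + 1, ?_⟩⟩
  rintro _ hlarge ⟨w, hw, rfl⟩
  obtain h | ⟨r, hr, hper, k, v, hv, hk, hlen⟩ :=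
    Yields.avoids_or_exists_isContextLength subset_rfl {A | ¬IsAperiodic R A} hw
  · exact absurd (hB s w h) (by omega)
  · have hv' := (Yields.of_mem hr (hv.mono (Set.sep_subset _ _))).length_mem_yieldLengths
    rw [hlen, add_assoc, add_comm v.length]
    exact hk _ (hperiod r hr hper _ hv')

end UnaryContextFree

section EventuallyPeriodic

open Filter

lemma add_mul_mem_of_forall_ge_add_mem {S : Set ℕ} {P B m : ℕ}
    (h : ∀ n ≥ B, n ∈ S → n + P ∈ S) (hm : B ≤ m) (hmS : m ∈ S) (i : ℕ) : m + P * i ∈ S := by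
  induction i with
  | zero => exact hmS
  | succ i ih =>
    rw [Nat.mul_succ, ← add_assoc]
    exact h _ (hm.trans (Nat.le_add_right _ _)) ih

lemma eventually_mem_iff_add_mem {S : Set ℕ} {P : ℕ} (hP : 0 < P)
    (h : ∀ᶠ n in atTop, n ∈ S → n + P ∈ S) : ∀ᶠ n in atTop, n ∈ S ↔ n + P ∈ S := by
  obtain ⟨B, hB⟩ := eventually_atTop.1 h
  have hresidue (j : ℕ) : ∀ᶠ n in atTop, n % P = j → (n ∈ S ↔ n + P ∈ S) := by
    by_cases hj : ∃ m ≥ B, m ∈ S ∧ m % P = j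
    · obtain ⟨m, hm, hmS, rfl⟩ := hj
      filter_upwards [eventually_ge_atTop m] with n hn hmod
      obtain ⟨i, hi⟩ := (Nat.modEq_iff_dvd' hn).1 hmod.symm
      have hnS : n ∈ S := by
        rw [← Nat.add_sub_cancel' hn, hi]
        exact add_mul_mem_of_forall_ge_add_mem hB hm hmS i
      exact iff_of_true hnS (hB n (hm.trans hn) hnS)
    · filter_upwards [eventually_ge_atTop B] with n hn hmod
      exact iff_of_false (fun hnS => hj ⟨n, hn, hnS, hmod⟩)
        fun hnS => hj ⟨n + P, by omega, hnS, by rwa [Nat.add_mod_right]⟩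
  filter_upwards [(eventually_all_finset (Finset.range P)).2 fun j _ => hresidue j] with n hn
  exact hn (n % P) (Finset.mem_range.2 (Nat.mod_lt n hP)) rfl

/-- The left quotient by a word depends only on its length modulo the period, once it is long. -/
lemma isRegular_setOf_length_mem {T : Type*} {S : Set ℕ} {P : ℕ} (hP : 0 < P)
    (h : ∀ᶠ n in atTop, n ∈ S ↔ n + P ∈ S) :
    Language.IsRegular ({w | w.length ∈ S} : Language T) := by
  obtain ⟨B, hB⟩ := eventually_atTop.1 h
  let quotient (n : ℕ) : Language T := {v | n + v.length ∈ S}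
  have hshift (n : ℕ) (hn : B ≤ n) : quotient (n + P) = quotient n := by
    ext v
    change n + P + v.length ∈ S ↔ n + v.length ∈ S
    rw [add_right_comm, ← hB (n + v.length) (by omega)]
  have hsmall (n : ℕ) : ∃ m < B + P, quotient m = quotient n := by
    induction n using Nat.strong_induction_on with
    | _ n ih =>
      by_cases hn : n < B + P
      · exact ⟨n, hn, rfl⟩
      · obtain ⟨m, hm, hmn⟩ := ih (n - P) (by omega)
        refine ⟨m, hm, hmn.trans ?_⟩
        rw [← hshift (n - P) (by omega), Nat.sub_add_cancel (by omega)]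
  refine .of_finite_range_leftQuotient (((Set.finite_lt_nat (B + P)).image quotient).subset ?_)
  rintro _ ⟨u, rfl⟩
  obtain ⟨m, hm, hmu⟩ := hsmall u.length
  refine ⟨m, hm, hmu.trans ?_⟩
  ext v
  change u.length + v.length ∈ S ↔ (u ++ v).length ∈ S
  rw [List.length_append]

end EventuallyPeriodic

theorem isRegular_of_isContextFree_of_subsingleton {T : Type*} [Subsingleton T] {L : Language T}
    (hL : L.IsContextFree) : L.IsRegular := by
  obtain ⟨N, R, A, hR, rfl⟩ := isContextFree_iff_exists_yieldLanguage_eq.1 hL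
  obtain ⟨P, hP, h⟩ := exists_eventually_add_mem_yieldLengths hR [.nonterminal A]
  have hlengths : yieldLanguage R A = {w | w.length ∈ yieldLengths R [.nonterminal A]} := by
    ext w
    refine ⟨fun hw => Yields.length_mem_yieldLengths hw, ?_⟩
    rintro ⟨v, hv, hlen⟩
    rwa [← List.ext_getElem hlen fun _ _ _ => Subsingleton.elim _ _]
  rw [hlengths]
  exact isRegular_setOf_length_mem hP (eventually_mem_iff_add_mem hP h)

/-! ### The automaton for `UPOWodd` -/

namespace UPOWodd

section LowerTri

variable {R : Type*} [CommRing R]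

/-- The matrix in `SL(2,R)` with first column `(x, y)` and second column `(0, x⁻¹)`. -/
def lowerTri (x : Rˣ) (y : R) : Matrix.SpecialLinearGroup (Fin 2) R :=
  ⟨!![(x : R), 0; y, (x⁻¹ : Rˣ)], by simp [Matrix.det_fin_two_of]⟩

lemma lowerTri_mul (x x' : Rˣ) (y y' : R) :
    lowerTri x y * lowerTri x' y' = lowerTri (x * x') (y * x' + (x⁻¹ : Rˣ) * y') :=
  Subtype.ext <| by
    rw [Matrix.SpecialLinearGroup.coe_mul]
    simp [lowerTri, mul_comm]

lemma lowerTri_eq_one_iff {x : Rˣ} {y : R} : lowerTri x y = 1 ↔ x = 1 ∧ y = 0 := by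
  refine ⟨fun h => ?_, ?_⟩
  · have hentry (i j : Fin 2) := congrFun₂ (congrArg Subtype.val h) i j
    exact ⟨Units.ext (hentry 0 0), hentry 1 0⟩
  · rintro ⟨rfl, rfl⟩
    exact Subtype.ext <| by simp [lowerTri, Matrix.one_fin_two]

lemma lowerTri_zero_pow (x : Rˣ) (n : ℕ) : lowerTri x 0 ^ n = lowerTri (x ^ n) 0 := by
  induction n with
  | zero => rw [pow_zero, pow_zero, lowerTri_eq_one_iff.2 ⟨rfl, rfl⟩]
  | succ n ih => simp [pow_succ, ih, lowerTri_mul]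

lemma lowerTri_one_pow (y : R) (n : ℕ) : lowerTri 1 y ^ n = lowerTri 1 (n * y) := by
  induction n with
  | zero => simp [lowerTri_eq_one_iff.2 ⟨rfl, rfl⟩]
  | succ n ih => simp [pow_succ, ih, lowerTri_mul, add_mul]

end LowerTri

section Automaton

open GroupAutomaton

lemma register_eq_lowerTri (m k j : ℕ) :
    A₁ * (A₂ ^ m * (A₃ ^ k * A₄ ^ j)) =
      lowerTri (.mk0 (2 : ℚ) two_ne_zero ^ (m + 1) / .mk0 2 two_ne_zero ^ j)
        ((2 ^ (2 * m + 1) - k) / (2 ^ (m + 1) * 2 ^ j)) := by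
  have h₁ : A₁ = lowerTri (.mk0 2 two_ne_zero) 1 := Subtype.ext <| by simp [A₁, lowerTri]
  have h₂ : A₂ = lowerTri (.mk0 2 two_ne_zero) 0 := Subtype.ext <| by simp [A₂, lowerTri]
  have h₃ : A₃ = lowerTri 1 (-1) := Subtype.ext <| by simp [A₃, lowerTri]
  have h₄ : A₄ = lowerTri (.mk0 2 two_ne_zero)⁻¹ 0 := Subtype.ext <| by simp [A₄, lowerTri]
  simp only [h₁, h₂, h₃, h₄, lowerTri_zero_pow, lowerTri_one_pow, lowerTri_mul]
  congr 1
  · rw [one_mul, ← mul_assoc, ← pow_succ', inv_pow, div_eq_mul_inv]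
  · simp
    field_simp
    ring

lemma register_eq_one_iff (m k j : ℕ) :
    A₁ * (A₂ ^ m * (A₃ ^ k * A₄ ^ j)) = 1 ↔ j = m + 1 ∧ k = 2 ^ (2 * m + 1) := by
  have hpow : (2 : ℚ) ^ (m + 1) * 2 ^ j ≠ 0 := by positivity
  rw [register_eq_lowerTri, lowerTri_eq_one_iff, div_eq_one, Units.ext_iff, div_eq_zero_iff,
    or_iff_left hpow, sub_eq_zero, eq_comm (b := (k : ℚ)), eq_comm (a := j)]
  refine and_congr ?_ (by norm_cast)
  exact (pow_right_injective₀ (a := (2 : ℚ)) two_pos (by norm_num)).eq_iff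

lemma mem_delta {q q' : Fin 5} {σ : Option Unit} {g : SLTwoRat} :
    (q', g) ∈ delta q σ ↔
      q = 0 ∧ σ = none ∧ q' = 1 ∧ g = A₁ ∨
      q = 1 ∧ σ = none ∧ q' = 1 ∧ g = A₂ ∨
      q = 1 ∧ σ = none ∧ q' = 2 ∧ g = 1 ∨
      q = 2 ∧ σ = some () ∧ q' = 2 ∧ g = A₃ ∨
      q = 2 ∧ σ = none ∧ q' = 3 ∧ g = 1 ∨
      q = 3 ∧ σ = none ∧ q' = 3 ∧ g = A₄ ∨
      q = 3 ∧ σ = none ∧ q' = 4 ∧ g = 1 := by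
  fin_cases q <;> obtain _ | ⟨⟩ := σ <;> simp [delta]

/-- The pairs of an input and a register change with which a computation can lead from the given
state to the accept state. -/
def Reaches : Fin 5 → List Unit → SLTwoRat → Prop
  | 0, w, g => ∃ m k j : ℕ, w = List.replicate k () ∧ g = A₁ * (A₂ ^ m * (A₃ ^ k * A₄ ^ j))
  | 1, w, g => ∃ m k j : ℕ, w = List.replicate k () ∧ g = A₂ ^ m * (A₃ ^ k * A₄ ^ j)
  | 2, w, g => ∃ k j : ℕ, w = List.replicate k () ∧ g = A₃ ^ k * A₄ ^ j
  | 3, w, g => ∃ j : ℕ, w = [] ∧ g = A₄ ^ j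
  | 4, w, g => w = [] ∧ g = 1

lemma Reaches.of_mem_delta {q q' : Fin 5} {σ : Option Unit} {w : List Unit} {g h : SLTwoRat}
    (hs : (q', g) ∈ delta q σ) (hr : Reaches q' w h) : Reaches q (σ.toList ++ w) (g * h) := by
  obtain ⟨rfl, rfl, rfl, rfl⟩ | ⟨rfl, rfl, rfl, rfl⟩ | ⟨rfl, rfl, rfl, rfl⟩ |
    ⟨rfl, rfl, rfl, rfl⟩ | ⟨rfl, rfl, rfl, rfl⟩ | ⟨rfl, rfl, rfl, rfl⟩ | ⟨rfl, rfl, rfl, rfl⟩ :=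
    mem_delta.1 hs
  · obtain ⟨m, k, j, rfl, rfl⟩ := hr
    exact ⟨m, k, j, rfl, rfl⟩
  · obtain ⟨m, k, j, rfl, rfl⟩ := hr
    exact ⟨m + 1, k, j, rfl, by rw [pow_succ', mul_assoc]⟩
  · obtain ⟨k, j, rfl, rfl⟩ := hr
    exact ⟨0, k, j, rfl, by rw [pow_zero]⟩
  · obtain ⟨k, j, rfl, rfl⟩ := hr
    exact ⟨k + 1, j, rfl, by rw [pow_succ', mul_assoc]⟩
  · obtain ⟨j, rfl, rfl⟩ := hr
    exact ⟨0, j, rfl, by rw [pow_zero]⟩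
  · obtain ⟨j, rfl, rfl⟩ := hr
    exact ⟨j + 1, rfl, by rw [pow_succ']⟩
  · obtain ⟨rfl, rfl⟩ := hr
    exact ⟨0, rfl, by rw [pow_zero, mul_one]⟩

lemma reaches_of_run {q q' : automaton.Q} {w : List Unit} {g : SLTwoRat}
    (h : automaton.Run q w g q') (hq' : q' = (4 : Fin 5)) : Reaches q w g := by
  induction h with
  | nil q => exact hq' ▸ ⟨rfl, rfl⟩
  | step hs _ ih => exact .of_mem_delta hs (ih hq')

lemma run_replicate_of_loop {A G : Type} [Group G] {E : GroupAutomaton A G} {q : E.Q} {a : A}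
    {g : G} (h : (q, g) ∈ E.step q (some a)) (k : ℕ) :
    E.Run q (List.replicate k a) (g ^ k) q := by
  induction k with
  | zero => rw [pow_zero]; exact .nil q
  | succ k ih => rw [pow_succ']; exact .step h ih

lemma run_pow_of_loop {A G : Type} [Group G] {E : GroupAutomaton A G} {q : E.Q} {g : G}
    (h : (q, g) ∈ E.step q none) (m : ℕ) : E.Run q [] (g ^ m) q := by
  induction m with
  | zero => rw [pow_zero]; exact .nil q
  | succ m ih => rw [pow_succ']; exact .step h ih

lemma run_automaton (m k j : ℕ) :
    automaton.Run (0 : Fin 5) (List.replicate k ()) (A₁ * (A₂ ^ m * (A₃ ^ k * A₄ ^ j)))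
      (4 : Fin 5) := by
  have hstep (q q' : Fin 5) (g : SLTwoRat) (hs : (q', g) ∈ delta q none) :
      automaton.Run q [] g q' := .of_mem_step (E := automaton) hs
  have h₀₁ := hstep 0 1 A₁ (by simp [mem_delta])
  have h₁₂ := hstep 1 2 1 (by simp [mem_delta])
  have h₂₃ := hstep 2 3 1 (by simp [mem_delta])
  have h₃₄ := hstep 3 4 1 (by simp [mem_delta])
  have h₁₁ := run_pow_of_loop (E := automaton) (q := (1 : Fin 5)) (g := A₂)
    (mem_delta.2 (by simp)) m
  have h₂₂ := run_replicate_of_loop (E := automaton) (q := (2 : Fin 5)) (a := ()) (g := A₃)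
    (mem_delta.2 (by simp)) k
  have h₃₃ := run_pow_of_loop (E := automaton) (q := (3 : Fin 5)) (g := A₄)
    (mem_delta.2 (by simp)) j
  have h := h₀₁.trans (h₁₁.trans (h₁₂.trans (h₂₂.trans (h₂₃.trans (h₃₃.trans h₃₄)))))
  simpa only [List.nil_append, List.append_nil, one_mul, mul_one] using h

theorem language_automaton : automaton.language = UPOWodd := by
  ext w
  rw [mem_language_iff_run]
  constructor
  · rintro ⟨q, hq, h⟩
    obtain ⟨m, k, j, rfl, hg⟩ := reaches_of_run h hq
    obtain ⟨-, rfl⟩ := (register_eq_one_iff m k j).1 hg.symm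
    exact ⟨m, rfl⟩
  · rintro ⟨m, rfl⟩
    refine ⟨(4 : Fin 5), rfl, ?_⟩
    rw [← (register_eq_one_iff m _ (m + 1)).2 ⟨rfl, rfl⟩]
    exact run_automaton m _ _

end Automaton

section NotRegular

lemma mem_iff_exists_length_eq {w : List Unit} :
    w ∈ UPOWodd ↔ ∃ n, w.length = 2 ^ (2 * n + 1) := by
  change (∃ n, w = List.replicate (2 ^ (2 * n + 1)) ()) ↔ _
  simp [List.eq_replicate_iff]

lemma two_pow_odd_add_ne {n k : ℕ} (hk : 0 < k) (hkn : k ≤ 2 ^ (2 * n + 1)) (m : ℕ) :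
    2 ^ (2 * n + 1) + k ≠ 2 ^ (2 * m + 1) := by
  intro h
  have hlt : 2 * n + 1 < 2 * m + 1 := (Nat.pow_lt_pow_iff_right one_lt_two).1 (by omega)
  have hle : 2 * m + 1 ≤ 2 * n + 1 + 1 :=
    (Nat.pow_le_pow_iff_right one_lt_two).1 (by rw [← h, pow_succ 2 (2 * n + 1)]; omega)
  omega

theorem not_isRegular : ¬UPOWodd.IsRegular := by
  rintro ⟨σ, _, M, hM⟩
  obtain ⟨n, hn⟩ : ∃ n, Fintype.card σ ≤ 2 ^ (2 * n + 1) :=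
    ⟨Fintype.card σ, (Nat.lt_two_pow_self.trans_le (Nat.pow_le_pow_right two_pos (by omega))).le⟩
  have hmem : List.replicate (2 ^ (2 * n + 1)) () ∈ M.accepts := hM ▸ ⟨n, rfl⟩
  obtain ⟨a, b, c, habc, hab, hb, hpump⟩ := M.pumping_lemma hmem (by rwa [List.length_replicate])
  have hpumped : a ++ (b ++ b) ++ c ∈ UPOWodd := by
    rw [← hM]
    refine hpump (Language.append_mem_mul (Language.append_mem_mul rfl ?_) rfl)
    exact Language.mem_kstar.2 ⟨[b, b], by simp, fun y hy => show y = b by simpa using hy⟩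
  obtain ⟨m, hm⟩ := mem_iff_exists_length_eq.1 hpumped
  have hlen := congrArg List.length habc
  simp only [List.length_replicate, List.length_append] at hlen hm
  have hbn : b.length ≤ 2 ^ (2 * n + 1) := (Nat.le_add_left _ _).trans (hab.trans hn)
  refine two_pow_odd_add_ne (List.length_pos_iff.2 hb) hbn m ?_
  rw [hlen, ← hm]
  ring

end NotRegular

end UPOWodd

theorem mainTheorem2 :
    languageClass SLTwoInt ⊂ languageClass SLTwoRat ∧
    UPOWodd.automaton.language = UPOWodd ∧
    ¬ UPOWodd.IsRegular ∧
    languageClass SLTwoInt = contextFreeClass ∧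
    (∀ L ∈ languageClass SLTwoInt, Nat.card L.alphabet = 1 → L.words.IsRegular) := by
  have hreg : ∀ L ∈ languageClass SLTwoInt, Nat.card L.alphabet = 1 → L.words.IsRegular := by
    intro L hL hcard
    have : Subsingleton L.alphabet := (Nat.card_eq_one_iff_unique.1 hcard).1
    exact isRegular_of_isContextFree_of_subsingleton
      (languageClass_SLTwoInt_eq_contextFreeClass.subset hL)
  have hsubset : languageClass SLTwoInt ⊆ languageClass SLTwoRat :=
    languageClass_subset_of_injective (f := Matrix.SpecialLinearGroup.map (Int.castRingHom ℚ))
      Matrix.SpecialLinearGroup.map_intCast_injective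
  have hnot_subset : ¬languageClass SLTwoRat ⊆ languageClass SLTwoInt := fun h =>
    UPOWodd.not_isRegular <| hreg ⟨Unit, inferInstance, UPOWodd⟩
      (h ⟨UPOWodd.automaton, UPOWodd.language_automaton⟩) (by simp)
  exact ⟨⟨hsubset, hnot_subset⟩, UPOWodd.language_automaton, UPOWodd.not_isRegular,
    languageClass_SLTwoInt_eq_contextFreeClass, hreg⟩
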